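/- A (finite or infinite) sequence $\sigma=(\sigma_k)_{k\ge 1}$ of positive integers with $\sigma_k\ge 2$ for all $k\ge 2$ is called an intercalation sequence. For positive integers $m,n$ let $\mathrm{mul}(m,n)=1$ if $m$ is a multiple of $n$ and $\mathrm{mul}(m,n)=0$ otherwise, and let $$L(\sigma,N)=\#\Big\{m\in\{1,\dots,N\}:\ \sum_{k\ge 1}(-1)^{k+1}\,\mathrm{mul}(m,\sigma_1\cdots\sigma_k)=1\Big\},$$ where the sum runs over those $k$ for which $\sigma_k$ is defined (this is the number of leap years among the years $1,\dots,N$). For $x\in[0,1]$ let $d_1(x)=\lfloor 1/x\rfloor$ and $T(x)=1-d_1(x)x$ if $x\ne 0$, let $d_1(0)=\infty$ and $T(0)=0$, and let $d_k(x)=d_1(T^{k-1}(x))$ for $k\ge 1$. The sequence $d(x)=(d_k(x))_{k\ge 1}$ is the Pierce expansion digit sequence of $x$. It is used as an intercalation sequence, the terms equal to $\infty$ being regarded as absent. Shallit's law of leap years holds at $x\in[0,1]$ if $$\limsup_{N\to\infty}\frac{Nx-L(d(x),N)}{\sqrt{\log N}}=\frac1{\sqrt2}\quad\text{and}\quad\liminf_{N\to\infty}\frac{Nx-L(d(x),N)}{\sqrt{\log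 N}}=-\frac1{\sqrt2},$$ where the limsup and liminf are taken in $[-\infty,\infty]$. Corollary 1.4 (leap year corollary). The set of exceptions to Shallit's law of leap years, i.e. the set of all $x\in[0,1]$ at which the law does not hold, is dense in $[0,1]$ and has Hausdorff dimension $1$. -/

import Mathlib

/-- A (finite or infinite) intercalation sequence is a map `σ : ℕ → ℕ∞`, where `σ k` is the
`(k + 1)`-th term and the value `⊤` marks an absent term (a finite sequence is continued by `⊤`).
`mulIndicator m q` is `1` if `m` is a multiple of `q`, and `0` if not; nothing here counts as a
multiple of `q = ⊤`. -/
noncomputable def LeapYear.mulIndicator (m : ℕ) (q : ℕ∞) : ℤ :=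
  open Classical in if ∃ n : ℕ, q = n ∧ n ∣ m then 1 else 0

/-- The year `m` is a leap year for the intercalation sequence `σ₁, σ₂, …`:
the sum over `k ≥ 1` of `(-1) ^ (k + 1) * mul (m, σ₁ ⋯ σ_k)` equals `1`.
(The summation index is shifted by one. If `m ≥ 1` and all terms from the second on are at least
`2`, only finitely many summands are nonzero.) -/
def LeapYear.IsLeapYear (σ : ℕ → ℕ∞) (m : ℕ) : Prop :=
  ∑ᶠ k : ℕ, (-1 : ℤ) ^ k * LeapYear.mulIndicator m (∏ j ∈ Finset.range (k + 1), σ j) = 1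

/-- The number of leap years among the years `1, …, N`. -/
noncomputable def LeapYear.leapCount (σ : ℕ → ℕ∞) (N : ℕ) : ℕ :=
  open Classical in ((Finset.Icc 1 N).filter (LeapYear.IsLeapYear σ)).card

/-- The first Pierce digit of `x ∈ [0,1]`. -/
noncomputable def Pierce.firstDigit (x : ℝ) : ℕ∞ :=
  open Classical in if x = 0 then ⊤ else ((⌊1 / x⌋₊ : ℕ) : ℕ∞)

/-- The Pierce map `T x = 1 - d₁(x) x` for `x ≠ 0`, `T 0 = 0`, on `[0,1]`. -/
noncomputable def Pierce.shift (x : ℝ) : ℝ :=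
  open Classical in if x = 0 then 0 else 1 - (⌊1 / x⌋₊ : ℝ) * x

/-- The Pierce digit sequence of `x`: `Pierce.digit x k` is `d_{k+1}(x) = d₁(T^k x)`. -/
noncomputable def Pierce.digit (x : ℝ) (k : ℕ) : ℕ∞ :=
  Pierce.firstDigit (Pierce.shift^[k] x)

/-- The normalized error `(N x - L(d(x), N)) / √(log N)`, as an extended real number. -/
noncomputable def LeapYear.normalizedError (x : ℝ) (N : ℕ) : EReal :=
  (((N * x - LeapYear.leapCount (Pierce.digit x) N) / √(Real.log N) : ℝ) : EReal)

/-- The conclusion of Shallit's law of leap years at the point `x`, with limsup and liminf taken in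
the extended real line. -/
def LeapYear.SatisfiesShallitLaw (x : ℝ) : Prop :=
  Filter.limsup (LeapYear.normalizedError x) Filter.atTop = ((1 / √2 : ℝ) : EReal) ∧
  Filter.liminf (LeapYear.normalizedError x) Filter.atTop = ((-(1 / √2) : ℝ) : EReal)

/-- The set of exceptions to Shallit's law of leap years in `[0,1]`. -/
def LeapYear.exceptionalSet : Set ℝ :=
  {x | x ∈ Set.Icc (0 : ℝ) 1 ∧ ¬ LeapYear.SatisfiesShallitLaw x}

/-! Up to a remainder, `N x - L(d(x), N)` is an alternating sum of the fractional parts of `N / (d₁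
⋯ d_k)` over the digit products up to `N`. It is thus bounded by the number of these products plus
one (`LeapYear.abs_error_le`). If that number is `O((log N)^(1/3))`, the normalized error tends to
`0` and the law fails. Rationals have finite expansions, hence bounded error, and are dense. For the
dimension, `u ∈ [0,1)` is coded by the free bits of digits chosen with `2^(k²) ≤ d_k < 2^(k²+1)`.
The products then grow like `2^(k³/3)` or faster, so every coded point is exceptional. If two codes
share exactly their first `k` digits, the parameters differ by at most `2^(-S)`, where `S = 1² + ⋯ +
k²`, while the Pierce series differ by at least `2^(-S - O(k²))`. Since `S` is cubic in `k`, the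
inverse of the coding is `s`-Hölder for every `s < 1` (`Pierce.exists_abs_sub_le_rpow`), which
forces dimension at least `s`. -/

/-! ### Leap-year counts as alternating sums of integer quotients. -/

open Finset in
theorem LeapYear.alternating_sum_antitone_eq_zero_or_one (K : ℕ) :
    ∀ (p : ℕ → Prop) [DecidablePred p], (∀ k, p (k + 1) → p k) →
      (∑ k ∈ range K, (-1 : ℤ) ^ k * (if p k then 1 else 0) = 0 ∨
        ∑ k ∈ range K, (-1 : ℤ) ^ k * (if p k then 1 else 0) = 1) := by
  induction K with
  | zero => intro p _ _; simp
  | succ K ih =>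
    intro p _ hp
    have hshift : ∑ k ∈ range (K + 1), (-1 : ℤ) ^ k * (if p k then 1 else 0) =
        (if p 0 then 1 else 0) -
          ∑ k ∈ range K, (-1 : ℤ) ^ k * (if p (k + 1) then 1 else 0) := by
      rw [sum_range_succ', sub_eq_add_neg, ← sum_neg_distrib, add_comm]
      congr 1
      · simp
      · exact sum_congr rfl fun k _ => by ring
    rw [hshift]
    by_cases h0 : p 0
    · rcases ih (fun k => p (k + 1)) (fun k => hp (k + 1)) with h | h <;> rw [h, if_pos h0] <;> norm_num
    · have hn : ∀ k, ¬ p k := fun k => by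
        induction k with
        | zero => exact h0
        | succ k ihk => exact fun h => ihk (hp k h)
      simp [hn]

theorem LeapYear.mulIndicator_natCast (m q : ℕ) :
    LeapYear.mulIndicator m q = if q ∣ m then 1 else 0 := by
  unfold LeapYear.mulIndicator
  simp

theorem LeapYear.mulIndicator_eq_zero_of_lt {m : ℕ} {q : ℕ∞} (hm : 0 < m) (h : (m : ℕ∞) < q) :
    LeapYear.mulIndicator m q = 0 := by
  unfold LeapYear.mulIndicator
  rw [if_neg]
  rintro ⟨n, rfl, hn⟩
  exact absurd (Nat.le_of_dvd hm hn) (not_le.mpr (by exact_mod_cast h))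

-- Divisibility by the successive products is antitone in `k`, so each year's alternating sum is `0`
-- or `1` and is itself the leap-year indicator. Summing over years counts the multiples of each
-- product; `hN` removes the terms from `K` on.
open Finset in
theorem LeapYear.leapCount_eq_sum {σ : ℕ → ℕ∞} {d : ℕ → ℕ} {K N : ℕ}
    (hd : ∀ j < K, σ j = d j) (hσ : ∀ j, 1 ≤ σ j) (hN : (N : ℕ∞) < ∏ j ∈ range (K + 1), σ j) :
    (LeapYear.leapCount σ N : ℤ) =
      ∑ k ∈ range K, (-1 : ℤ) ^ k * ((N / ∏ j ∈ range (k + 1), d j : ℕ) : ℤ) := by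
  classical
  have hmono : ∀ a b, a ≤ b → ∏ j ∈ range a, σ j ≤ ∏ j ∈ range b, σ j := fun a b hab =>
    prod_le_prod_of_subset_of_one_le' (range_subset_range.mpr hab) fun j _ _ => hσ j
  have hprod : ∀ k < K, ∏ j ∈ range (k + 1), σ j = ((∏ j ∈ range (k + 1), d j : ℕ) : ℕ∞) := by
    intro k hk
    rw [Nat.cast_prod]
    exact prod_congr rfl fun j hj => hd j (by have := mem_range.mp hj; omega)
  set I : ℕ → ℤ := fun m =>
    ∑ k ∈ range K, (-1 : ℤ) ^ k * (if (∏ j ∈ range (k + 1), d j) ∣ m then 1 else 0) with hI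
  have hsum : ∀ m ∈ Icc 1 N, (∑ᶠ k : ℕ, (-1 : ℤ) ^ k *
      LeapYear.mulIndicator m (∏ j ∈ range (k + 1), σ j)) = I m := by
    intro m hm
    obtain ⟨h1, h2⟩ := mem_Icc.mp hm
    rw [finsum_eq_sum_of_support_subset (s := range K)]
    · refine sum_congr rfl fun k hk => ?_
      rw [hprod k (mem_range.mp hk), LeapYear.mulIndicator_natCast]
    · intro k hk
      by_contra hk'
      refine hk ?_
      have hKk : K ≤ k := by simpa using hk'
      show _ * _ = (0 : ℤ)
      rw [LeapYear.mulIndicator_eq_zero_of_lt h1, mul_zero]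
      exact lt_of_lt_of_le (lt_of_le_of_lt (by exact_mod_cast h2) hN) (hmono _ _ (by omega))
  have h01 : ∀ m, I m = 0 ∨ I m = 1 := fun m =>
    LeapYear.alternating_sum_antitone_eq_zero_or_one K
      (fun k => (∏ j ∈ range (k + 1), d j) ∣ m)
      fun k h => (Dvd.intro _ (prod_range_succ d (k + 1)).symm).trans h
  have hcount : (LeapYear.leapCount σ N : ℤ) = ∑ m ∈ Icc 1 N, I m := by
    unfold LeapYear.leapCount
    rw [card_filter, Nat.cast_sum]
    refine sum_congr (by rfl) fun m hm => ?_
    unfold LeapYear.IsLeapYear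
    rw [hsum m hm]
    rcases h01 m with h | h <;> simp [h]
  rw [hcount, hI, sum_comm]
  refine sum_congr rfl fun k _ => ?_
  rw [← mul_sum]
  congr 1
  rw [← Nat.Ioc_filter_dvd_card_eq_div, card_filter, Nat.cast_sum]
  exact sum_congr rfl fun m _ => by split_ifs <;> simp

/-! ### Finite Pierce expansion with remainder, and the error bound. -/

theorem Pierce.shift_of_ne_zero {x : ℝ} (hx : x ≠ 0) :
    Pierce.shift x = 1 - (⌊1 / x⌋₊ : ℝ) * x := by simp [Pierce.shift, hx]

theorem Pierce.firstDigit_of_ne_zero {x : ℝ} (hx : x ≠ 0) :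
    Pierce.firstDigit x = ((⌊1 / x⌋₊ : ℕ) : ℕ∞) := by simp [Pierce.firstDigit, hx]

theorem Pierce.shift_mem_Icc {x : ℝ} (hx : x ∈ Set.Icc (0 : ℝ) 1) :
    Pierce.shift x ∈ Set.Icc (0 : ℝ) 1 := by
  rcases eq_or_ne x 0 with rfl | h0
  · simp [Pierce.shift]
  · have hpos : 0 < x := lt_of_le_of_ne hx.1 h0.symm
    rw [Pierce.shift_of_ne_zero h0]
    have h1 : (⌊1 / x⌋₊ : ℝ) ≤ 1 / x := Nat.floor_le (by positivity)
    have h2 : (⌊1 / x⌋₊ : ℝ) * x ≤ 1 := by rwa [le_div_iff₀ hpos] at h1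
    exact ⟨by linarith, by nlinarith [Nat.cast_nonneg (α := ℝ) ⌊1 / x⌋₊]⟩

theorem Pierce.iterate_shift_mem_Icc {x : ℝ} (hx : x ∈ Set.Icc (0 : ℝ) 1) (k : ℕ) :
    Pierce.shift^[k] x ∈ Set.Icc (0 : ℝ) 1 := by
  induction k with
  | zero => exact hx
  | succ k ih => rw [Function.iterate_succ_apply']; exact Pierce.shift_mem_Icc ih

theorem Pierce.one_le_floor_inv {x : ℝ} (hx : x ∈ Set.Icc (0 : ℝ) 1) (h0 : x ≠ 0) :
    1 ≤ ⌊1 / x⌋₊ := by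
  have hpos : 0 < x := lt_of_le_of_ne hx.1 h0.symm
  exact Nat.le_floor (by rw [le_div_iff₀ hpos]; simpa using hx.2)

theorem Pierce.one_le_digit {x : ℝ} (hx : x ∈ Set.Icc (0 : ℝ) 1) (k : ℕ) :
    1 ≤ Pierce.digit x k := by
  unfold Pierce.digit
  have hk := Pierce.iterate_shift_mem_Icc hx k
  by_cases h0 : Pierce.shift^[k] x = 0
  · simp [Pierce.firstDigit, h0]
  · rw [Pierce.firstDigit_of_ne_zero h0]
    exact_mod_cast Pierce.one_le_floor_inv hk h0

open Finset in
theorem Pierce.eq_sum_add_remainder {x : ℝ} (hx : x ∈ Set.Icc (0 : ℝ) 1) {d : ℕ → ℕ} :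
    ∀ {K : ℕ}, (∀ j < K, Pierce.digit x j = d j) →
      x = ∑ k ∈ range K, (-1 : ℝ) ^ k / ((∏ j ∈ range (k + 1), d j : ℕ) : ℝ) +
        (-1) ^ K * Pierce.shift^[K] x / ((∏ j ∈ range K, d j : ℕ) : ℝ) := by
  intro K
  induction K with
  | zero => intro _; simp
  | succ K ih =>
    intro hd
    have h0 : Pierce.shift^[K] x ≠ 0 := by
      intro h
      have := hd K (by omega)
      simp [Pierce.digit, Pierce.firstDigit, h] at this
    have hdK : ⌊1 / Pierce.shift^[K] x⌋₊ = d K := by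
      have := hd K (by omega)
      rw [Pierce.digit, Pierce.firstDigit_of_ne_zero h0] at this
      exact_mod_cast this
    have hdpos : ∀ j < K + 1, (d j : ℝ) ≠ 0 := by
      intro j hj
      have := Pierce.one_le_digit hx j
      rw [hd j hj] at this
      have : 1 ≤ d j := by exact_mod_cast this
      positivity
    have hP : ((∏ j ∈ range K, d j : ℕ) : ℝ) ≠ 0 := by
      rw [Nat.cast_prod]
      exact prod_ne_zero_iff.mpr fun j hj => hdpos j (by have := mem_range.mp hj; omega)
    have hK := hdpos K (by omega)
    have e := ih fun j hj => hd j (by omega)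
    rw [sum_range_succ, Function.iterate_succ_apply', Pierce.shift_of_ne_zero h0, hdK,
      prod_range_succ, Nat.cast_mul]
    refine e.trans ?_
    rw [add_assoc]
    congr 1
    field_simp
    ring

open Finset in
/-- If exactly the first `K` digit products of `x` are at most `N`, then `N x` differs from the
number of leap years by at most `K + 1`. -/
theorem LeapYear.abs_error_le {x : ℝ} (hx : x ∈ Set.Icc (0 : ℝ) 1) {d : ℕ → ℕ} {K N : ℕ}
    (hd : ∀ j < K, Pierce.digit x j = d j)
    (hN : (N : ℕ∞) < ∏ j ∈ range (K + 1), Pierce.digit x j) :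
    |N * x - LeapYear.leapCount (Pierce.digit x) N| ≤ K + 1 := by
  have hL := LeapYear.leapCount_eq_sum hd (Pierce.one_le_digit hx) hN
  have hL' : (LeapYear.leapCount (Pierce.digit x) N : ℝ) =
      ∑ k ∈ range K, (-1 : ℝ) ^ k * ((N / ∏ j ∈ range (k + 1), d j : ℕ) : ℝ) := by
    rw [← Int.cast_natCast (R := ℝ), hL, Int.cast_sum]
    refine sum_congr rfl fun k _ => ?_
    rw [Int.cast_mul, Int.cast_pow, Int.cast_neg, Int.cast_one, Int.cast_natCast]
  set r : ℝ := (-1) ^ K * Pierce.shift^[K] x / ((∏ j ∈ range K, d j : ℕ) : ℝ) with hr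
  have hexp : (N : ℝ) * x - LeapYear.leapCount (Pierce.digit x) N =
      ∑ k ∈ range K, (-1 : ℝ) ^ k * (N / ((∏ j ∈ range (k + 1), d j : ℕ) : ℝ) -
        ((N / ∏ j ∈ range (k + 1), d j : ℕ) : ℝ)) + N * r := by
    conv_lhs => rw [hL', Pierce.eq_sum_add_remainder hx hd]
    rw [mul_add, mul_sum, add_sub_right_comm, ← sum_sub_distrib]
    congr 1
    exact sum_congr rfl fun k _ => by ring
  have hterm : ∀ k ∈ range K, |(-1 : ℝ) ^ k * (N / ((∏ j ∈ range (k + 1), d j : ℕ) : ℝ) -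
        ((N / ∏ j ∈ range (k + 1), d j : ℕ) : ℝ))| ≤ 1 := by
    intro k _
    rw [abs_mul, abs_pow, abs_neg, abs_one, one_pow, one_mul, ← Nat.floor_div_eq_div (K := ℝ)]
    have h1 := Nat.floor_le (a := (N / ((∏ j ∈ range (k + 1), d j : ℕ) : ℝ))) (by positivity)
    have h2 := Nat.lt_floor_add_one (N / ((∏ j ∈ range (k + 1), d j : ℕ) : ℝ))
    rw [abs_le]
    constructor <;> linarith
  have hKmem := Pierce.iterate_shift_mem_Icc hx K
  have hrem : |N * r| ≤ 1 := by
    rw [hr, abs_mul, abs_div, abs_mul, abs_pow, abs_neg, abs_one, one_pow, one_mul,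
      abs_of_nonneg hKmem.1, Nat.abs_cast, Nat.abs_cast]
    -- Either the remainder vanishes, or the next digit is finite and its product with `T^K x` is at
    -- most `1`, which offsets the factor `N`.
    by_cases h0 : Pierce.shift^[K] x = 0
    · simp [h0]
    · have hpos : 0 < Pierce.shift^[K] x := lt_of_le_of_ne hKmem.1 (Ne.symm h0)
      have hprod : (N : ℕ∞) < ((∏ j ∈ range K, d j) * ⌊1 / Pierce.shift^[K] x⌋₊ : ℕ) := by
        rw [prod_range_succ, prod_congr rfl fun j hj => hd j (mem_range.mp hj),
          Pierce.digit, Pierce.firstDigit_of_ne_zero h0] at hN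
        exact_mod_cast hN
      have h1 : (N : ℝ) < (∏ j ∈ range K, d j : ℕ) * (⌊1 / Pierce.shift^[K] x⌋₊ : ℝ) := by
        exact_mod_cast hprod
      have h2 : (⌊1 / Pierce.shift^[K] x⌋₊ : ℝ) * Pierce.shift^[K] x ≤ 1 := by
        rw [← le_div_iff₀ hpos]
        exact Nat.floor_le (by positivity)
      have hP : (0 : ℝ) < (∏ j ∈ range K, d j : ℕ) := by
        rcases Nat.eq_zero_or_pos (∏ j ∈ range K, d j) with h | h
        · rw [h] at h1
          simp only [Nat.cast_zero, zero_mul] at h1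
          exact absurd h1 (not_lt.mpr (Nat.cast_nonneg N))
        · exact_mod_cast h
      rw [← mul_div_assoc, div_le_one hP]
      calc (N : ℝ) * Pierce.shift^[K] x
          ≤ ((∏ j ∈ range K, d j : ℕ) * (⌊1 / Pierce.shift^[K] x⌋₊ : ℝ)) *
              Pierce.shift^[K] x := by gcongr
        _ = (∏ j ∈ range K, d j : ℕ) * ((⌊1 / Pierce.shift^[K] x⌋₊ : ℝ) *
              Pierce.shift^[K] x) := by ring
        _ ≤ (∏ j ∈ range K, d j : ℕ) := mul_le_of_le_one_right hP.le h2
  rw [hexp]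
  calc _ ≤ |∑ k ∈ range K, (-1 : ℝ) ^ k * (N / ((∏ j ∈ range (k + 1), d j : ℕ) : ℝ) -
        ((N / ∏ j ∈ range (k + 1), d j : ℕ) : ℝ))| + |N * r| := abs_add_le _ _
    _ ≤ (∑ k ∈ range K, (1 : ℝ)) + 1 :=
        add_le_add ((abs_sum_le_sum_abs _ _).trans (sum_le_sum hterm)) hrem
    _ = K + 1 := by simp

/-! ### Small error refutes the law. -/

open Filter Topology in
/-- The law fails wherever the error is negligible compared with `√(log N)`. -/
theorem LeapYear.not_satisfiesShallitLaw_of_tendsto {x : ℝ}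
    (h : Tendsto (fun N : ℕ => (N * x - LeapYear.leapCount (Pierce.digit x) N) /
      √(Real.log N)) atTop (𝓝 0)) : ¬ LeapYear.SatisfiesShallitLaw x := by
  rintro ⟨hsup, -⟩
  have ht : Tendsto (LeapYear.normalizedError x) atTop (𝓝 ((0 : ℝ) : EReal)) :=
    (continuous_coe_real_ereal.tendsto 0).comp h
  rw [ht.limsup_eq, EReal.coe_eq_coe_iff] at hsup
  have : (0 : ℝ) < 1 / √2 := by positivity
  linarith

open Filter Topology in
/-- If the error is `O((log N) ^ (1 / 3))`, it is negligible compared with `√(log N)`. -/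
theorem LeapYear.tendsto_error_of_cube_le {x C : ℝ} {K : ℕ → ℕ}
    (hK : ∀ᶠ N : ℕ in atTop, (K N : ℝ) ^ 3 ≤ C * Real.log N)
    (hE : ∀ᶠ N : ℕ in atTop, |N * x - LeapYear.leapCount (Pierce.digit x) N| ≤ K N + 1) :
    Tendsto (fun N : ℕ => (N * x - LeapYear.leapCount (Pierce.digit x) N) /
      √(Real.log N)) atTop (𝓝 0) := by
  have hlog : Tendsto (fun N : ℕ => Real.log N) atTop atTop :=
    Real.tendsto_log_atTop.comp tendsto_natCast_atTop_atTop
  set B : ℝ := max C 0 with hB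
  -- Here `1/6 = 1/2 - 1/3`, and the `+ 1` is absorbed because `(log N)^(1/3) ≥ 1` eventually.
  have hlim : Tendsto (fun N : ℕ => (B ^ (1 / 3 : ℝ) + 1) * Real.log N ^ (-(1 / 6 : ℝ)))
      atTop (𝓝 0) := by
    have := ((tendsto_rpow_neg_atTop (by norm_num : (0 : ℝ) < 1 / 6)).comp hlog).const_mul
      (B ^ (1 / 3 : ℝ) + 1)
    simpa using this
  refine squeeze_zero_norm' ?_ hlim
  filter_upwards [hK, hE, hlog.eventually_ge_atTop 1] with N hN hEN hl
  have hl0 : 0 < Real.log N := by linarith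
  have hK1 : (K N : ℝ) ≤ B ^ (1 / 3 : ℝ) * Real.log N ^ (1 / 3 : ℝ) := by
    rw [← Real.mul_rpow (le_max_right _ _) hl0.le]
    calc (K N : ℝ) = ((K N : ℝ) ^ 3) ^ (1 / 3 : ℝ) := by
          rw [← Real.rpow_natCast, ← Real.rpow_mul (Nat.cast_nonneg _)]; norm_num
      _ ≤ (B * Real.log N) ^ (1 / 3 : ℝ) := by
          refine Real.rpow_le_rpow (by positivity) (hN.trans ?_) (by norm_num)
          exact mul_le_mul_of_nonneg_right (le_max_left _ _) hl0.le
  have h1 : (1 : ℝ) ≤ Real.log N ^ (1 / 3 : ℝ) := Real.one_le_rpow hl (by norm_num)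
  rw [Real.norm_eq_abs, abs_div, abs_of_nonneg (Real.sqrt_nonneg _),
    div_le_iff₀ (Real.sqrt_pos.mpr hl0), Real.sqrt_eq_rpow, mul_assoc, ← Real.rpow_add hl0]
  norm_num only
  linarith

/-! ### Rational points and density. -/

/-- The Pierce shift sends `p / q` to `(q % p) / q`. -/
theorem Pierce.shift_div {p q : ℕ} (hp : p ≠ 0) (hq : q ≠ 0) :
    Pierce.shift ((p : ℝ) / q) = ((q % p : ℕ) : ℝ) / q := by
  have hp' : (p : ℝ) ≠ 0 := by exact_mod_cast hp
  have hq' : (q : ℝ) ≠ 0 := by exact_mod_cast hq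
  rw [Pierce.shift_of_ne_zero (div_ne_zero hp' hq'), one_div_div, Nat.floor_div_eq_div]
  have h : ((q % p : ℕ) : ℝ) + p * ((q / p : ℕ) : ℝ) = q := by exact_mod_cast Nat.mod_add_div q p
  field_simp
  linarith

theorem Pierce.exists_iterate_shift_eq_zero {q : ℕ} (hq : q ≠ 0) (p : ℕ) :
    ∃ K, Pierce.shift^[K] ((p : ℝ) / q) = 0 := by
  induction p using Nat.strong_induction_on with
  | _ p ih =>
    rcases eq_or_ne p 0 with rfl | hp
    · exact ⟨0, by simp⟩
    · obtain ⟨K, hK⟩ := ih (q % p) (Nat.mod_lt _ (Nat.pos_of_ne_zero hp))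
      exact ⟨K + 1, by rw [Function.iterate_succ_apply, Pierce.shift_div hp hq, hK]⟩

open Filter Finset in
/-- Points with a finite Pierce expansion are exceptions to the law. -/
theorem LeapYear.mem_exceptionalSet_of_iterate_shift_eq_zero {x : ℝ}
    (hx : x ∈ Set.Icc (0 : ℝ) 1) (h : ∃ K, Pierce.shift^[K] x = 0) :
    x ∈ LeapYear.exceptionalSet := by
  classical
  refine ⟨hx, LeapYear.not_satisfiesShallitLaw_of_tendsto ?_⟩
  have hd : ∀ j < Nat.find h, Pierce.digit x j = ((⌊1 / Pierce.shift^[j] x⌋₊ : ℕ) : ℕ∞) :=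
    fun j hj => Pierce.firstDigit_of_ne_zero (Nat.find_min h hj)
  have hlog : Tendsto (fun N : ℕ => Real.log N) atTop atTop :=
    Real.tendsto_log_atTop.comp tendsto_natCast_atTop_atTop
  refine LeapYear.tendsto_error_of_cube_le (C := 1) (K := fun _ => Nat.find h) ?_ ?_
  · simpa using hlog.eventually_ge_atTop ((Nat.find h : ℝ) ^ 3)
  · refine Eventually.of_forall fun N => LeapYear.abs_error_le hx hd ?_
    -- The first absent digit makes the product infinite, so one `K` serves every `N`.
    have htop : Pierce.digit x (Nat.find h) = ⊤ := by
      simp [Pierce.digit, Pierce.firstDigit, Nat.find_spec h]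
    rw [prod_range_succ, htop, ENat.mul_top]
    · exact ENat.natCast_lt_top N
    · exact prod_ne_zero_iff.mpr fun j _ =>
        (lt_of_lt_of_le zero_lt_one (Pierce.one_le_digit hx j)).ne'

theorem LeapYear.dense_exceptionalSet :
    Dense {x : Set.Icc (0 : ℝ) 1 | (x : ℝ) ∈ LeapYear.exceptionalSet} := by
  rw [Metric.dense_iff]
  rintro ⟨x, hx⟩ r hr
  obtain ⟨n, hn⟩ := exists_nat_one_div_lt hr
  have hq : ((n + 1 : ℕ) : ℝ) ≠ 0 := by positivity
  have hqpos : (0 : ℝ) < ((n + 1 : ℕ) : ℝ) := by positivity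
  have hfl := Nat.floor_le (a := ((n + 1 : ℕ) : ℝ) * x) (mul_nonneg hqpos.le hx.1)
  have hfl' := Nat.lt_floor_add_one (((n + 1 : ℕ) : ℝ) * x)
  set p := ⌊((n + 1 : ℕ) : ℝ) * x⌋₊
  have hle : (p : ℝ) / ((n + 1 : ℕ) : ℝ) ≤ x := by rw [div_le_iff₀ hqpos]; linarith
  have hmem : (p : ℝ) / ((n + 1 : ℕ) : ℝ) ∈ Set.Icc (0 : ℝ) 1 := ⟨by positivity, hle.trans hx.2⟩
  refine ⟨⟨_, hmem⟩, ?_, LeapYear.mem_exceptionalSet_of_iterate_shift_eq_zero hmem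
    (Pierce.exists_iterate_shift_eq_zero n.succ_ne_zero p)⟩
  rw [Metric.mem_ball, Subtype.dist_eq, Real.dist_eq, abs_sub_comm, abs_of_nonneg (by linarith)]
  have : x < p / ((n + 1 : ℕ) : ℝ) + 1 / ((n : ℝ) + 1) := by
    rw [Nat.cast_succ, ← add_div, lt_div_iff₀ (by positivity)]
    push_cast at hfl'
    linarith
  dsimp only
  linarith

/-! ### Infinite Pierce series: digits and separation. -/

/-- The value `∑ (-1) ^ k / (d₀ ⋯ d_k)` of the Pierce series with digits `d`. -/
noncomputable def Pierce.series (d : ℕ → ℕ) : ℝ :=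
  ∑' k : ℕ, (-1 : ℝ) ^ k / ((∏ j ∈ Finset.range (k + 1), d j : ℕ) : ℝ)

open Finset in
theorem Pierce.norm_series_term_le {d : ℕ → ℕ} (hd : ∀ k, 2 ≤ d k) (k : ℕ) :
    ‖(-1 : ℝ) ^ k / ((∏ j ∈ range (k + 1), d j : ℕ) : ℝ)‖ ≤ 1 / 2 / 2 ^ k := by
  have h : 2 ^ (k + 1) ≤ ∏ j ∈ range (k + 1), d j := by
    simpa using prod_le_prod' (s := range (k + 1)) (f := fun _ => 2) fun j _ => hd j
  have h' : (2 : ℝ) ^ (k + 1) ≤ ((∏ j ∈ range (k + 1), d j : ℕ) : ℝ) := by exact_mod_cast h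
  rw [norm_div, norm_pow, norm_neg, norm_one, one_pow, div_div, ← pow_succ', Real.norm_natCast]
  exact one_div_le_one_div_of_le (by positivity) h'

theorem Pierce.summable_series {d : ℕ → ℕ} (hd : ∀ k, 2 ≤ d k) :
    Summable fun k : ℕ =>
      (-1 : ℝ) ^ k / ((∏ j ∈ Finset.range (k + 1), d j : ℕ) : ℝ) :=
  .of_norm_bounded (summable_geometric_two' 1) (Pierce.norm_series_term_le hd)

theorem Pierce.series_eq {d : ℕ → ℕ} (hd : ∀ k, 2 ≤ d k) :
    Pierce.series d = (1 - Pierce.series fun k => d (k + 1)) / d 0 := by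
  unfold Pierce.series
  rw [(Pierce.summable_series hd).tsum_eq_zero_add, sub_div, ← tsum_div_const, sub_eq_add_neg,
    ← tsum_neg]
  congr 1
  · simp
  · refine tsum_congr fun k => ?_
    rw [Finset.prod_range_succ', Nat.cast_mul, ← div_div, pow_succ]
    ring

theorem Pierce.series_le_one {d : ℕ → ℕ} (hd : ∀ k, 2 ≤ d k) : Pierce.series d ≤ 1 :=
  (Real.le_norm_self _).trans
    (tsum_of_norm_bounded (hasSum_geometric_two' 1) (Pierce.norm_series_term_le hd))

theorem Pierce.series_nonneg {d : ℕ → ℕ} (hd : ∀ k, 2 ≤ d k) : 0 ≤ Pierce.series d := by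
  rw [Pierce.series_eq hd]
  exact div_nonneg (sub_nonneg.mpr (Pierce.series_le_one fun k => hd (k + 1))) (Nat.cast_nonneg _)

theorem Pierce.series_le_one_div {d : ℕ → ℕ} (hd : ∀ k, 2 ≤ d k) :
    Pierce.series d ≤ 1 / d 0 := by
  rw [Pierce.series_eq hd]
  gcongr
  linarith [Pierce.series_nonneg fun k => hd (k + 1)]

theorem Pierce.series_pos {d : ℕ → ℕ} (hd : ∀ k, 2 ≤ d k) : 0 < Pierce.series d := by
  have h0 : (2 : ℝ) ≤ d 0 := by exact_mod_cast hd 0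
  have h1 : (2 : ℝ) ≤ d 1 := by exact_mod_cast hd 1
  rw [Pierce.series_eq hd]
  have h := Pierce.series_le_one_div fun k => hd (k + 1)
  have : 1 / (d 1 : ℝ) ≤ 1 / 2 := one_div_le_one_div_of_le (by norm_num) h1
  exact div_pos (by simp only [zero_add] at h; linarith) (by linarith)

/-- The inverse is `d 0 / (1 - t)` with `t` the shifted series; it is below `d 0 + 1` exactly when
`t < 1 / (d 0 + 1)`, and `t ≤ 1 / d 1`. -/
theorem Pierce.floor_inv_series {d : ℕ → ℕ} (hd : ∀ k, 2 ≤ d k) (hd' : d 0 + 1 < d 1) :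
    ⌊1 / Pierce.series d⌋₊ = d 0 := by
  have h0 : (2 : ℝ) ≤ d 0 := by exact_mod_cast hd 0
  have hpos := Pierce.series_pos hd
  have h1 : (d 0 : ℝ) + 1 < d 1 := by exact_mod_cast hd'
  rw [Nat.floor_eq_iff (by positivity)]
  constructor
  · rw [le_div_iff₀ hpos, mul_comm, ← le_div_iff₀ (by linarith)]
    exact Pierce.series_le_one_div hd
  · have h : (Pierce.series fun k => d (k + 1)) < 1 / (d 0 + 1) :=
      (Pierce.series_le_one_div fun k => hd (k + 1)).trans_lt
        (one_div_lt_one_div_of_lt (by linarith) (by simpa using h1))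
    rw [div_lt_iff₀ hpos, Pierce.series_eq hd, mul_div_assoc', lt_div_iff₀ (by linarith)]
    rw [lt_div_iff₀ (by linarith)] at h
    linarith

theorem Pierce.shift_series {d : ℕ → ℕ} (hd : ∀ k, 2 ≤ d k) (hd' : d 0 + 1 < d 1) :
    Pierce.shift (Pierce.series d) = Pierce.series fun k => d (k + 1) := by
  have h0 : (2 : ℝ) ≤ d 0 := by exact_mod_cast hd 0
  rw [Pierce.shift_of_ne_zero (Pierce.series_pos hd).ne', Pierce.floor_inv_series hd hd',
    Pierce.series_eq hd, mul_div_cancel₀ _ (by linarith)]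
  ring

theorem Pierce.iterate_shift_series (k : ℕ) : ∀ {d : ℕ → ℕ}, (∀ k, 2 ≤ d k) →
    (∀ k, d k + 1 < d (k + 1)) →
      Pierce.shift^[k] (Pierce.series d) = Pierce.series fun j => d (j + k) := by
  induction k with
  | zero => intros; rfl
  | succ k ih =>
    intro d hd hd'
    rw [Function.iterate_succ_apply, Pierce.shift_series hd (hd' 0),
      ih (fun j => hd (j + 1)) (fun j => hd' (j + 1))]
    congr 1

/-- A sufficiently fast growing sequence is the Pierce digit sequence of the sum of its series. -/
theorem Pierce.digit_series {d : ℕ → ℕ} (hd : ∀ k, 2 ≤ d k) (hd' : ∀ k, d k + 1 < d (k + 1))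
    (k : ℕ) : Pierce.digit (Pierce.series d) k = d k := by
  have hk : ∀ j, 2 ≤ d (j + k) := fun j => hd (j + k)
  rw [Pierce.digit, Pierce.iterate_shift_series k hd hd',
    Pierce.firstDigit_of_ne_zero (Pierce.series_pos hk).ne',
    Pierce.floor_inv_series hk (by simpa [Nat.add_comm 1 k] using hd' k), zero_add]

/-- The leading terms differ by at least `1 / (d 0 * e 0)`, and `hgap` lets the tail of `d` cost at
most half of this. -/
theorem Pierce.series_sub_ge {d e : ℕ → ℕ} (hd : ∀ k, 2 ≤ d k) (he : ∀ k, 2 ≤ e k)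
    (hlt : d 0 < e 0) (hgap : 2 * e 0 ≤ d 1) :
    1 / (2 * d 0 * e 0 : ℝ) ≤ Pierce.series d - Pierce.series e := by
  have d0 : (2 : ℝ) ≤ d 0 := by exact_mod_cast hd 0
  have e0 : (2 : ℝ) ≤ e 0 := by exact_mod_cast he 0
  have hlt' : (d 0 : ℝ) + 1 ≤ e 0 := by exact_mod_cast hlt
  have hgap' : 2 * (e 0 : ℝ) ≤ d 1 := by exact_mod_cast hgap
  have he1 := Pierce.series_le_one_div he
  have ht : (Pierce.series fun k => d (k + 1)) ≤ 1 / (2 * e 0) :=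
    (Pierce.series_le_one_div fun k => hd (k + 1)).trans
      (one_div_le_one_div_of_le (by linarith) (by simpa using hgap'))
  have hd1 : (1 - 1 / (2 * e 0 : ℝ)) / d 0 ≤ Pierce.series d := by
    rw [Pierce.series_eq hd]
    gcongr
  have hkey : 1 / (2 * d 0 * e 0 : ℝ) ≤ (1 - 1 / (2 * e 0 : ℝ)) / d 0 - 1 / e 0 := by
    have : (1 - 1 / (2 * e 0 : ℝ)) / d 0 - 1 / e 0 - 1 / (2 * d 0 * e 0 : ℝ) =
        ((e 0 : ℝ) - d 0 - 1) / (d 0 * e 0) := by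
      have h1 : (d 0 : ℝ) ≠ 0 := by linarith
      have h2 : (e 0 : ℝ) ≠ 0 := by linarith
      field_simp
      ring
    have h3 : 0 ≤ ((e 0 : ℝ) - d 0 - 1) / (d 0 * e 0) := div_nonneg (by linarith) (by positivity)
    linarith
  linarith

open Finset in
/-- Two Pierce series whose digits first differ at position `k` are quantitatively separated. -/
theorem Pierce.abs_series_sub_ge (k : ℕ) : ∀ {d e : ℕ → ℕ}, (∀ k, 2 ≤ d k) → (∀ k, 2 ≤ e k) →
    (∀ j < k, d j = e j) → d k ≠ e k → 2 * e k ≤ d (k + 1) → 2 * d k ≤ e (k + 1) →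
    1 / (2 * d k * e k * (∏ j ∈ range k, d j : ℕ) : ℝ) ≤ |Pierce.series d - Pierce.series e| := by
  induction k with
  | zero =>
    intro d e hd he _ hne h1 h2
    rcases lt_or_gt_of_ne hne with h | h
    · simpa using (Pierce.series_sub_ge hd he h h1).trans (le_abs_self _)
    · have := (Pierce.series_sub_ge he hd h h2).trans (le_abs_self _)
      rw [abs_sub_comm, mul_right_comm] at this
      simpa using this
  | succ k ih =>
    intro d e hd he heq hne h1 h2
    have h := ih (fun j => hd (j + 1)) (fun j => he (j + 1))
      (fun j hj => heq (j + 1) (by omega)) hne h1 h2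
    have d0 : (0 : ℝ) < d 0 := by exact_mod_cast (hd 0).trans_lt' two_pos
    -- A common first digit acts by `y ↦ (1 - y) / d 0`, so it only divides the distance by `d 0`.
    rw [Pierce.series_eq hd, Pierce.series_eq he, ← heq 0 (by omega), ← sub_div, abs_div,
      sub_sub_sub_cancel_left, abs_sub_comm, Nat.abs_cast, prod_range_succ', Nat.cast_mul,
      ← mul_assoc, ← div_div]
    gcongr

/-! ### Coding `[0,1)` by fast growing digits. -/

/-- The exponent `∑_{j < k} (j + 1) ^ 2`. -/
def Pierce.squareSum (k : ℕ) : ℕ := ∑ j ∈ Finset.range k, (j + 1) ^ 2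

theorem Pierce.squareSum_succ (k : ℕ) :
    Pierce.squareSum (k + 1) = Pierce.squareSum k + (k + 1) ^ 2 := Finset.sum_range_succ _ _

theorem Pierce.le_squareSum (k : ℕ) : k ≤ Pierce.squareSum k := by
  induction k with
  | zero => simp
  | succ k ih => rw [Pierce.squareSum_succ]; nlinarith

theorem Pierce.cube_le_squareSum (k : ℕ) : k ^ 3 ≤ 3 * Pierce.squareSum k := by
  induction k with
  | zero => simp
  | succ k ih => rw [Pierce.squareSum_succ]; nlinarith

/-- The `k`-th fast growing digit attached to `u ∈ [0,1)`: `2 ^ (k + 1) ^ 2` plus the `k`-th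
digit of `u` in the mixed radix system with bases `2 ^ (j + 1) ^ 2`. -/
noncomputable def Pierce.fastDigit (u : ℝ) (k : ℕ) : ℕ :=
  2 ^ (k + 1) ^ 2 + ⌊2 ^ Pierce.squareSum (k + 1) * u⌋₊ % 2 ^ (k + 1) ^ 2

theorem Pierce.le_fastDigit (u : ℝ) (k : ℕ) : 2 ^ (k + 1) ^ 2 ≤ Pierce.fastDigit u k :=
  Nat.le_add_right _ _

theorem Pierce.fastDigit_lt (u : ℝ) (k : ℕ) : Pierce.fastDigit u k < 2 ^ ((k + 1) ^ 2 + 1) := by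
  have := Nat.mod_lt ⌊2 ^ Pierce.squareSum (k + 1) * u⌋₊
    (show 0 < 2 ^ (k + 1) ^ 2 by positivity)
  rw [Pierce.fastDigit, pow_succ]
  omega

theorem Pierce.two_le_fastDigit (u : ℝ) (k : ℕ) : 2 ≤ Pierce.fastDigit u k :=
  le_trans (Nat.le_self_pow (by positivity) 2) (Pierce.le_fastDigit u k)

theorem Pierce.two_mul_fastDigit_le (u v : ℝ) (k : ℕ) :
    2 * Pierce.fastDigit u k ≤ Pierce.fastDigit v (k + 1) := by
  have h1 := Pierce.fastDigit_lt u k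
  have h2 := Pierce.le_fastDigit v (k + 1)
  have h3 : 2 ^ ((k + 1) ^ 2 + 2) ≤ 2 ^ (k + 1 + 1) ^ 2 :=
    Nat.pow_le_pow_right two_pos (by ring_nf; omega)
  rw [pow_succ] at h1
  rw [pow_add] at h3
  omega

theorem Pierce.fastDigit_add_one_lt (u : ℝ) (k : ℕ) :
    Pierce.fastDigit u k + 1 < Pierce.fastDigit u (k + 1) := by
  have := Pierce.two_mul_fastDigit_le u u k
  have := Pierce.two_le_fastDigit u k
  omega

open Finset in
theorem Pierce.prod_fastDigit_le (u : ℝ) (k : ℕ) :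
    ∏ j ∈ range k, Pierce.fastDigit u j ≤ 2 ^ (Pierce.squareSum k + k) := by
  induction k with
  | zero => simp [Pierce.squareSum]
  | succ k ih =>
    rw [prod_range_succ, Pierce.squareSum_succ]
    refine (Nat.mul_le_mul ih (Pierce.fastDigit_lt u k).le).trans_eq ?_
    rw [← pow_add]
    congr 1
    ring

open Finset in
theorem Pierce.le_prod_fastDigit (u : ℝ) (k : ℕ) :
    2 ^ Pierce.squareSum k ≤ ∏ j ∈ range k, Pierce.fastDigit u j := by
  induction k with
  | zero => simp [Pierce.squareSum]
  | succ k ih =>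
    rw [prod_range_succ, Pierce.squareSum_succ, pow_add]
    exact Nat.mul_le_mul ih (Pierce.le_fastDigit u k)

/-- Dropping the last mixed-radix digit of the truncation leaves the previous truncation, so equal
digits give equal truncations by induction. -/
theorem Pierce.floor_two_pow_succ_div (u : ℝ) (k : ℕ) :
    ⌊2 ^ Pierce.squareSum (k + 1) * u⌋₊ / 2 ^ (k + 1) ^ 2 = ⌊2 ^ Pierce.squareSum k * u⌋₊ := by
  rw [← Nat.floor_div_natCast, Pierce.squareSum_succ, pow_add]
  congr 1
  push_cast
  field_simp

theorem Pierce.floor_eq_of_fastDigit_eq {u v : ℝ} (hu : u ∈ Set.Ico (0 : ℝ) 1)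
    (hv : v ∈ Set.Ico (0 : ℝ) 1) {k : ℕ}
    (h : ∀ j < k, Pierce.fastDigit u j = Pierce.fastDigit v j) :
    ⌊2 ^ Pierce.squareSum k * u⌋₊ = ⌊2 ^ Pierce.squareSum k * v⌋₊ := by
  induction k with
  | zero =>
    simp [Pierce.squareSum, Nat.floor_eq_zero.mpr hu.2, Nat.floor_eq_zero.mpr hv.2]
  | succ k ih =>
    have hk := h k (by omega)
    rw [Pierce.fastDigit, Pierce.fastDigit, Nat.add_left_cancel_iff] at hk
    rw [← Nat.div_add_mod ⌊2 ^ Pierce.squareSum (k + 1) * u⌋₊ (2 ^ (k + 1) ^ 2), hk,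
      Pierce.floor_two_pow_succ_div, ih fun j hj => h j (by omega),
      ← Pierce.floor_two_pow_succ_div v, Nat.div_add_mod]

theorem Pierce.abs_sub_le_of_fastDigit_eq {u v : ℝ} (hu : u ∈ Set.Ico (0 : ℝ) 1)
    (hv : v ∈ Set.Ico (0 : ℝ) 1) {k : ℕ}
    (h : ∀ j < k, Pierce.fastDigit u j = Pierce.fastDigit v j) :
    |u - v| ≤ 1 / 2 ^ Pierce.squareSum k := by
  have hf := Pierce.floor_eq_of_fastDigit_eq hu hv h
  have hp : (0 : ℝ) < 2 ^ Pierce.squareSum k := by positivity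
  have u1 := Nat.floor_le (mul_nonneg hp.le hu.1)
  have u2 := Nat.lt_floor_add_one (2 ^ Pierce.squareSum k * u)
  have v1 := Nat.floor_le (mul_nonneg hp.le hv.1)
  have v2 := Nat.lt_floor_add_one (2 ^ Pierce.squareSum k * v)
  rw [hf] at u1 u2
  have hmul : |u - v| * 2 ^ Pierce.squareSum k = |(u - v) * 2 ^ Pierce.squareSum k| := by
    rw [abs_mul, abs_of_pos hp]
  rw [le_div_iff₀ hp, hmul, abs_le]
  constructor <;> nlinarith

theorem Pierce.exists_fastDigit_ne {u v : ℝ} (hu : u ∈ Set.Ico (0 : ℝ) 1)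
    (hv : v ∈ Set.Ico (0 : ℝ) 1) (hne : u ≠ v) :
    ∃ k, Pierce.fastDigit u k ≠ Pierce.fastDigit v k := by
  by_contra! h
  have hpos : 0 < |u - v| := abs_pos.mpr (sub_ne_zero.mpr hne)
  obtain ⟨n, hn⟩ := exists_pow_lt_of_lt_one hpos (by norm_num : (1 / 2 : ℝ) < 1)
  have h1 := Pierce.abs_sub_le_of_fastDigit_eq hu hv (k := n) fun j _ => h j
  have h2 := Pierce.le_squareSum n
  have h3 : 1 / (2 : ℝ) ^ Pierce.squareSum n ≤ (1 / 2) ^ n := by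
    rw [one_div_pow]
    exact one_div_le_one_div_of_le (by positivity) (pow_le_pow_right₀ (by norm_num) h2)
  linarith

/-! ### Hölder estimate and Hausdorff dimension. -/

/-- The exponents in the separation estimate are asymptotically dominated by `squareSum`. -/
theorem Pierce.exists_exponent_bound {s : ℝ} (hs0 : 0 < s) (hs1 : s < 1) :
    ∃ C : ℝ, ∀ k : ℕ, s * (Pierce.squareSum k + k + 2 * (k + 1) ^ 2 + 3) ≤
      Pierce.squareSum k + C := by
  have hs : 0 < 1 - s := by linarith
  -- The quadratic part is at most `8 k² + 8`. Past `k = 24 / (1 - s)`, the bound `k³ / 3` on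
  -- `squareSum` gives `(1 - s) * squareSum k ≥ 8 k²`; below it, the constant suffices.
  refine ⟨8 + 8 * (24 / (1 - s)) ^ 2, fun k => ?_⟩
  have hcube : (k : ℝ) ^ 3 ≤ 3 * Pierce.squareSum k := by exact_mod_cast Pierce.cube_le_squareSum k
  have hk : (k : ℝ) ≤ k ^ 2 := by exact_mod_cast Nat.le_self_pow two_ne_zero k
  have hk0 : (0 : ℝ) ≤ k := Nat.cast_nonneg k
  have hq : s * (k + 2 * ((k : ℝ) + 1) ^ 2 + 3) ≤ 8 * (k : ℝ) ^ 2 + 8 :=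
    (mul_le_of_le_one_left (by positivity) hs1.le).trans (by nlinarith)
  have hmain : 8 * (k : ℝ) ^ 2 ≤ (1 - s) * Pierce.squareSum k + 8 * (24 / (1 - s)) ^ 2 := by
    rcases le_total (k : ℝ) (24 / (1 - s)) with h | h
    · have : (k : ℝ) ^ 2 ≤ (24 / (1 - s)) ^ 2 := pow_le_pow_left₀ hk0 h 2
      nlinarith [mul_nonneg hs.le (Nat.cast_nonneg (α := ℝ) (Pierce.squareSum k))]
    · rw [div_le_iff₀ hs] at h
      have h1 := mul_le_mul_of_nonneg_left h (sq_nonneg (k : ℝ))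
      have h2 := mul_le_mul_of_nonneg_left hcube hs.le
      nlinarith [sq_nonneg (24 / (1 - s))]
  linarith

open Finset in
theorem Pierce.exists_abs_sub_le_rpow {s : ℝ} (hs0 : 0 < s) (hs1 : s < 1) :
    ∃ C : NNReal, ∀ u ∈ Set.Ico (0 : ℝ) 1, ∀ v ∈ Set.Ico (0 : ℝ) 1,
      |u - v| ≤ C * |Pierce.series (Pierce.fastDigit u) - Pierce.series (Pierce.fastDigit v)| ^ s := by
  classical
  obtain ⟨C, hC⟩ := Pierce.exists_exponent_bound hs0 hs1
  refine ⟨⟨(2 : ℝ) ^ C, by positivity⟩, fun u hu v hv => ?_⟩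
  show _ ≤ (2 : ℝ) ^ C * _
  rcases eq_or_ne u v with rfl | hne
  · simp [Real.zero_rpow hs0.ne']
  have hex := Pierce.exists_fastDigit_ne hu hv hne
  set k := Nat.find hex
  have heq : ∀ j < k, Pierce.fastDigit u j = Pierce.fastDigit v j := fun j hj =>
    not_not.mp (Nat.find_min hex hj)
  have huv := Pierce.abs_sub_le_of_fastDigit_eq hu hv heq
  have hsep := Pierce.abs_series_sub_ge k (Pierce.two_le_fastDigit u) (Pierce.two_le_fastDigit v)
    heq (Nat.find_spec hex) (Pierce.two_mul_fastDigit_le v u k) (Pierce.two_mul_fastDigit_le u v k)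
  -- The `3` collects the factor `2` and one extra bit from each of the two differing digits; the
  -- summand `k` is one extra bit per earlier digit.
  have hden : 2 * Pierce.fastDigit u k * Pierce.fastDigit v k *
      (∏ j ∈ range k, Pierce.fastDigit u j) ≤
        2 ^ (Pierce.squareSum k + k + 2 * (k + 1) ^ 2 + 3) := by
    calc _ ≤ 2 * 2 ^ ((k + 1) ^ 2 + 1) * 2 ^ ((k + 1) ^ 2 + 1) *
          2 ^ (Pierce.squareSum k + k) := by
          gcongr
          · exact (Pierce.fastDigit_lt u k).le
          · exact (Pierce.fastDigit_lt v k).le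
          · exact Pierce.prod_fastDigit_le u k
      _ = _ := by ring
  have hpos : 0 < 2 * Pierce.fastDigit u k * Pierce.fastDigit v k *
      (∏ j ∈ range k, Pierce.fastDigit u j) := by
    have : 0 < ∏ j ∈ range k, Pierce.fastDigit u j :=
      prod_pos fun j _ => two_pos.trans_le (Pierce.two_le_fastDigit u j)
    have := two_pos.trans_le (Pierce.two_le_fastDigit u k)
    have := two_pos.trans_le (Pierce.two_le_fastDigit v k)
    positivity
  have hlow : (2 : ℝ) ^ (-((Pierce.squareSum k : ℝ) + k + 2 * (k + 1) ^ 2 + 3)) ≤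
      |Pierce.series (Pierce.fastDigit u) - Pierce.series (Pierce.fastDigit v)| := by
    refine le_trans ?_ hsep
    rw [Real.rpow_neg (by norm_num), ← one_div]
    refine one_div_le_one_div_of_le (by exact_mod_cast hpos) ?_
    exact_mod_cast hden
  calc |u - v| ≤ 1 / 2 ^ Pierce.squareSum k := huv
    _ = (2 : ℝ) ^ (-(Pierce.squareSum k : ℝ)) := by
        rw [Real.rpow_neg (by norm_num), Real.rpow_natCast, one_div]
    _ ≤ (2 : ℝ) ^ (C + -((Pierce.squareSum k : ℝ) + k + 2 * (k + 1) ^ 2 + 3) * s) :=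
        Real.rpow_le_rpow_of_exponent_le (by norm_num) (by linarith [hC k])
    _ = (2 : ℝ) ^ C * ((2 : ℝ) ^ (-((Pierce.squareSum k : ℝ) + k + 2 * (k + 1) ^ 2 + 3))) ^ s := by
        rw [Real.rpow_add (by norm_num), Real.rpow_mul (by norm_num)]
    _ ≤ _ := by gcongr

open Finset Filter in
theorem LeapYear.series_fastDigit_mem_exceptionalSet (u : ℝ) :
    Pierce.series (Pierce.fastDigit u) ∈ LeapYear.exceptionalSet := by
  classical
  set x := Pierce.series (Pierce.fastDigit u) with hxdef
  have h2 := Pierce.two_le_fastDigit u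
  have hx : x ∈ Set.Icc (0 : ℝ) 1 := ⟨Pierce.series_nonneg h2, Pierce.series_le_one h2⟩
  have hdig : ∀ k, Pierce.digit x k = Pierce.fastDigit u k :=
    Pierce.digit_series h2 (Pierce.fastDigit_add_one_lt u)
  have hex : ∀ N : ℕ, ∃ K, N < ∏ j ∈ range (K + 1), Pierce.fastDigit u j := fun N =>
    ⟨N, calc N < 2 ^ N := Nat.lt_two_pow_self
      _ ≤ 2 ^ (N + 1) := Nat.pow_le_pow_right two_pos N.le_succ
      _ ≤ _ := by simpa using prod_le_prod' (s := range (N + 1)) (f := fun _ => 2) fun j _ => h2 j⟩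
  refine ⟨hx, LeapYear.not_satisfiesShallitLaw_of_tendsto ?_⟩
  refine LeapYear.tendsto_error_of_cube_le (C := 3 / Real.log 2) (K := fun N => Nat.find (hex N))
    ?_ (Eventually.of_forall fun N => ?_)
  · filter_upwards [eventually_ge_atTop 1] with N hN
    -- By minimality, the product of the first `K` digits is at most `N`; for `K = 0` this is `N ≥
    -- 1`.
    have hle : 2 ^ Pierce.squareSum (Nat.find (hex N)) ≤ N := by
      rcases Nat.eq_zero_or_pos (Nat.find (hex N)) with h | h
      · simpa [h, Pierce.squareSum] using hN
      · have := Nat.find_min (hex N) (Nat.sub_lt h one_pos)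
        rw [Nat.sub_add_cancel (show 1 ≤ _ from h), not_lt] at this
        exact (Pierce.le_prod_fastDigit u _).trans this
    have hl2 : 0 < Real.log 2 := Real.log_pos (by norm_num)
    have hlog : Pierce.squareSum (Nat.find (hex N)) * Real.log 2 ≤ Real.log N := by
      rw [← Real.log_pow]
      exact Real.log_le_log (by positivity) (by exact_mod_cast hle)
    have hcube : (Nat.find (hex N) : ℝ) ^ 3 ≤ 3 * Pierce.squareSum (Nat.find (hex N)) := by
      exact_mod_cast Pierce.cube_le_squareSum _
    rw [div_mul_eq_mul_div, le_div_iff₀ hl2]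
    nlinarith
  · refine LeapYear.abs_error_le hx (fun j _ => hdig j) ?_
    rw [prod_congr rfl fun j _ => hdig j, ← Nat.cast_prod]
    exact_mod_cast Nat.find_spec (hex N)

-- An `s`-Hölder map divides dimension by at most `s`: the inverse coding maps a set of exceptions
-- onto `[0,1)`, so `1 ≤ dimH / s`.
open Set in
theorem LeapYear.le_dimH_exceptionalSet {s : NNReal} (hs0 : 0 < s) (hs1 : s < 1) :
    (s : ENNReal) ≤ dimH LeapYear.exceptionalSet := by
  set g : ℝ → ℝ := fun u => Pierce.series (Pierce.fastDigit u) with hg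
  obtain ⟨C, hC⟩ := Pierce.exists_abs_sub_le_rpow (s := s) (by exact_mod_cast hs0)
    (by exact_mod_cast hs1)
  have hinj : InjOn g (Ico 0 1) := fun u hu v hv huv => by
    have := hC u hu v hv
    simp only [hg] at huv
    rw [huv, sub_self, abs_zero, Real.zero_rpow (by exact_mod_cast hs0.ne'), mul_zero] at this
    exact sub_eq_zero.mp (abs_nonpos_iff.mp this)
  have hinv : LeftInvOn (Function.invFunOn g (Ico 0 1)) g (Ico 0 1) := hinj.leftInvOn_invFunOn
  have hholder : HolderOnWith C s (Function.invFunOn g (Ico 0 1)) (g '' Ico 0 1) := by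
    rintro _ ⟨u, hu, rfl⟩ _ ⟨v, hv, rfl⟩
    rw [hinv hu, hinv hv, edist_nndist, edist_nndist, ← ENNReal.coe_rpow_of_nonneg _ s.coe_nonneg,
      ← ENNReal.coe_mul, ENNReal.coe_le_coe, ← NNReal.coe_le_coe]
    push_cast
    simpa [Real.dist_eq] using hC u hu v hv
  have h := hholder.dimH_image_le hs0
  rw [hinv.image_image, Real.dimH_of_nonempty_interior (by simp),
    ENNReal.le_div_iff_mul_le (.inl (by exact_mod_cast hs0.ne')) (.inl ENNReal.coe_ne_top)] at h
  simp only [Module.finrank_self, Nat.cast_one, one_mul] at h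
  refine h.trans (dimH_mono ?_)
  rintro _ ⟨u, -, rfl⟩
  exact LeapYear.series_fastDigit_mem_exceptionalSet u

theorem LeapYear.dimH_exceptionalSet : dimH LeapYear.exceptionalSet = 1 := by
  refine le_antisymm ((dimH_mono (Set.subset_univ _)).trans_eq Real.dimH_univ) ?_
  refine le_of_forall_lt fun a ha => ?_
  obtain ⟨s, has, hs1⟩ := ENNReal.lt_iff_exists_nnreal_btwn.mp ha
  exact has.trans_le (LeapYear.le_dimH_exceptionalSet
    (by exact_mod_cast pos_of_gt has) (by exact_mod_cast hs1))

/-- The exceptional set is dense in `[0,1]` (subspace topology) and has Hausdorff dimension `1`. -/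
theorem corollary1p4 :
    Dense {x : Set.Icc (0 : ℝ) 1 | (x : ℝ) ∈ LeapYear.exceptionalSet} ∧
      dimH LeapYear.exceptionalSet = 1 :=
  ⟨LeapYear.dense_exceptionalSet, LeapYear.dimH_exceptionalSet⟩
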